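/- Let $d\ge 1$. A tiling of $\mathbb{R}^d$ is a countable collection $\mathcal{T}$ of convex polytopes with nonempty interior (the tiles) whose union is $\mathbb{R}^d$ and whose interiors are pairwise disjoint. A point $x$ is a vertex of $\mathcal{T}$ if it is a vertex of at least one tile; its vertex corona is $x$ together with the set of all tiles that contain $x$. The tiling is monocoronal if for any two vertices $x,y$ there is an isometry $p\mapsto t+Rp$ of $\mathbb{R}^d$ ($t\in\mathbb{R}^d$, $R\in O(d)$) that maps $x$ to $y$ and the set of tiles containing $x$ onto the set of tiles containing $y$; it is monocoronal up to rigid motions if one can always choose $R\in SO(d)$. It is face-to-face if the intersection of any two tiles is a (possibly empty) face of both of them. It is non-periodic if no translation by a nonzero vector maps $\mathcal{T}$ onto itself. **Theorem.** For every $d\ge 3$ there is a non-periodic, non-face-to-face tiling of $\mathbb{R}^d$ that is monocoronal. For every $d\ge 4$ there is a non-periodic, non-face-to-face tiling of $\mathbb{R}^d$ that is monocoronal up to rigid motions. -/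

import Mathlib

namespace Tilings

/-- `d`-dimensional Euclidean space. -/
abbrev Space (d : ℕ) : Type := EuclideanSpace ℝ (Fin d)

/-- A full-dimensional convex polytope: the convex hull of finitely many points, with nonempty
interior. -/
def IsConvexPolytope {d : ℕ} (P : Set (Space d)) : Prop :=
  (∃ V : Finset (Space d), P = convexHull ℝ (V : Set (Space d))) ∧ (interior P).Nonempty

/-- A tiling: a countable collection of compact sets (the tiles) that is a covering and a packing
(distinct tiles have disjoint interiors). -/
structure IsTiling {d : ℕ} (𝒯 : Set (Set (Space d))) : Prop where
  countable : 𝒯.Countable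
  isCompact : ∀ T ∈ 𝒯, IsCompact T
  covering : ⋃₀ 𝒯 = Set.univ
  packing : ∀ S ∈ 𝒯, ∀ T ∈ 𝒯, S ≠ T → interior S ∩ interior T = ∅

/-- A tiling all of whose tiles are convex polytopes. -/
def IsPolytopeTiling {d : ℕ} (𝒯 : Set (Set (Space d))) : Prop :=
  IsTiling 𝒯 ∧ ∀ T ∈ 𝒯, IsConvexPolytope T

/-- `F` is a face of the convex polytope `P`: the empty set, or the set of points of `P` at which
some linear functional attains its maximum over `P`. (The zero functional gives `P` itself.) -/
def IsFace {d : ℕ} (P F : Set (Space d)) : Prop := IsExposed ℝ P F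

/-- A tiling is face-to-face if the intersection of two tiles is always a face (possibly empty, of
any dimension) of both of the tiles. -/
def IsFaceToFace {d : ℕ} (𝒯 : Set (Set (Space d))) : Prop :=
  ∀ S ∈ 𝒯, ∀ T ∈ 𝒯, IsFace S (S ∩ T) ∧ IsFace T (S ∩ T)

/-- `x` is a vertex of the tiling if it is a vertex (that is, an extreme point) of at least one of
the tiles. -/
def IsVertex {d : ℕ} (𝒯 : Set (Set (Space d))) (x : Space d) : Prop :=
  ∃ T ∈ 𝒯, x ∈ Set.extremePoints ℝ T

/-- The vertex-corona of `x`: the point `x` together with the set of all tiles that contain `x`. -/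
def corona {d : ℕ} (𝒯 : Set (Set (Space d))) (x : Space d) : Space d × Set (Set (Space d)) :=
  (x, {T ∈ 𝒯 | x ∈ T})

/-- The map `p ↦ t + R p` carries the corona `A` onto the corona `B`: it maps the distinguished
point to the distinguished point and the collection of tiles onto the collection of tiles. -/
def Carries {d : ℕ} (R : Space d ≃ₗᵢ[ℝ] Space d) (t : Space d)
    (A B : Space d × Set (Set (Space d))) : Prop :=
  t + R A.1 = B.1 ∧ (fun T : Set (Space d) => (fun p => t + R p) '' T) '' A.2 = B.2

/-- Congruence of coronae: `R` ranges over the orthogonal group (mirror images allowed). -/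
def Congruent {d : ℕ} (A B : Space d × Set (Set (Space d))) : Prop :=
  ∃ (R : Space d ≃ₗᵢ[ℝ] Space d) (t : Space d), Carries R t A B

/-- Direct congruence of coronae: `R` ranges over the special orthogonal group (mirror images
forbidden). -/
def DirectlyCongruent {d : ℕ} (A B : Space d × Set (Set (Space d))) : Prop :=
  ∃ (R : Space d ≃ₗᵢ[ℝ] Space d) (t : Space d),
    LinearMap.det (R.toLinearEquiv : Space d →ₗ[ℝ] Space d) = 1 ∧ Carries R t A B

/-- Monocoronal (up to congruence): all vertex-coronae are congruent. -/
def IsMonocoronal {d : ℕ} (𝒯 : Set (Set (Space d))) : Prop :=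
  ∀ x y, IsVertex 𝒯 x → IsVertex 𝒯 y → Congruent (corona 𝒯 x) (corona 𝒯 y)

/-- Monocoronal up to rigid motions: all vertex-coronae are directly congruent. -/
def IsMonocoronalRigid {d : ℕ} (𝒯 : Set (Set (Space d))) : Prop :=
  ∀ x y, IsVertex 𝒯 x → IsVertex 𝒯 y → DirectlyCongruent (corona 𝒯 x) (corona 𝒯 y)

/-- The symmetry group of a tiling: the isometries of the space that map the collection of tiles
onto itself. -/
def symmetryGroup {d : ℕ} (𝒯 : Set (Set (Space d))) : Set (Space d ≃ᵢ Space d) :=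
  {φ | (fun T : Set (Space d) => φ '' T) '' 𝒯 = 𝒯}

/-- The vectors `v` for which the translation `p ↦ p + v` belongs to the symmetry group. -/
def translationVectors {d : ℕ} (𝒯 : Set (Set (Space d))) : Set (Space d) :=
  {v | IsometryEquiv.addRight v ∈ symmetryGroup 𝒯}

/-- A tiling is `k`-periodic if `k` is the maximal number of linearly independent translations in
its symmetry group. -/
def IsKPeriodic {d : ℕ} (k : ℕ) (𝒯 : Set (Set (Space d))) : Prop :=
  Module.finrank ℝ (Submodule.span ℝ (translationVectors 𝒯)) = k

/-- A `0`-periodic tiling is called non-periodic. -/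
def IsNonPeriodic {d : ℕ} (𝒯 : Set (Set (Space d))) : Prop := IsKPeriodic 0 𝒯

end Tilings

open scoped Pointwise RealInnerProductSpace

namespace Tilings

/-! In the hyperplane orthogonal to a unit axis take the lattice spanned by `b_i` with `⟪b_i, b_i⟫ =
4` and `⟪b_i, b_j⟫ = 3`, and fill the slabs between consecutive integer heights with prisms over its
cells. Adjacent slabs differ by a mirror: a reflection along some `b_i`, offset so that `0` goes to
`b_i / 4`. The index is free at each interface.

Locally the choice is invisible. Exchanging two `b_i` is an isometry, the mirror combined with
reversal of the axis interchanges the two slabs, and the symmetries of an interface are transitive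
on the vertices of one slab (`exists_smul_pair_eq_smul_zero_eq`). If a third and a second index
besides `i` exist, exchanging them preserves the interface and reverses orientation, so rigid
motions suffice from dimension 4 on. The offset prevents the tiling from being face-to-face.

Globally the choices exclude periods. A horizontal period, pulled back to each slab, must stay in
the lattice under all flips. Where two indices alternate, its inner products with the flipped edges
are integers with `2 p (l + 2) + 3 p (l + 1) + 2 p l = 0`; a long run forces high powers of 2 to
divide them, and since they are bounded they vanish (`eq_zero_of_forall_mem_lattice`). A period that
changes height would carry an edge into the lattice after a few alternating flips, but the
denominators grow (`not_mem_lattice_of_alternating`). -/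

/-- Affine isometries act on the space by evaluation. -/
noncomputable instance affineIsometryAction (d : ℕ) : MulAction (Space d ≃ᵃⁱ[ℝ] Space d) (Space d) where
  smul g x := g x
  one_smul _ := rfl
  mul_smul _ _ _ := rfl

/-- The translation by `v`. -/
noncomputable def translation {d : ℕ} (v : Space d) : Space d ≃ᵃⁱ[ℝ] Space d :=
  AffineIsometryEquiv.constVAdd ℝ (Space d) v

@[simp] theorem translation_smul {d : ℕ} (v x : Space d) : translation v • x = v + x := rfl

/-- The reflection in the hyperplane through the origin orthogonal to `v`. -/
noncomputable def hyperplaneReflection {d : ℕ} (v : Space d) : Space d ≃ₗᵢ[ℝ] Space d :=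
  (ℝ ∙ v)ᗮ.reflection

theorem hyperplaneReflection_apply {d : ℕ} (v x : Space d) :
    hyperplaneReflection v x = x - (2 * ⟪v, x⟫ / ⟪v, v⟫) • v := by
  have h := Submodule.reflection_singleton_apply (𝕜 := ℝ) v x
  rw [hyperplaneReflection, Submodule.reflection_orthogonal_apply, h, real_inner_self_eq_norm_sq]
  simp only [RCLike.ofReal_real_eq_id, id_eq, neg_sub, two_smul, ← add_smul, two_mul,
    add_div]

/-- A linear isometry as an affine isometry. -/
noncomputable def linear {d : ℕ} (R : Space d ≃ₗᵢ[ℝ] Space d) : Space d ≃ᵃⁱ[ℝ] Space d :=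
  R.toAffineIsometryEquiv

@[simp] theorem linear_smul {d : ℕ} (R : Space d ≃ₗᵢ[ℝ] Space d) (x : Space d) :
    linear R • x = R x := rfl

theorem affineIsometry_ext {d : ℕ} {f g : Space d ≃ᵃⁱ[ℝ] Space d} (h : ∀ x : Space d, f • x = g • x) :
    f = g := AffineIsometryEquiv.ext h

theorem mul_translation {d : ℕ} (g : Space d ≃ᵃⁱ[ℝ] Space d) (v : Space d) :
    g * translation v = translation (g.linearIsometryEquiv v) * g :=
  affineIsometry_ext fun x => by
    rw [mul_smul, mul_smul, translation_smul, translation_smul]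
    exact g.map_vadd x v

/-! ### The lattice basis and its coordinates -/

/-- A basis of `Space (m + 1)` consisting of a unit vector (the axis) and `m` vectors orthogonal to
the axis with Gram matrix `1 + 3 J`, where `J` is the all-ones matrix. -/
structure Frame (m : ℕ) where
  basis : Module.Basis (Fin (m + 1)) ℝ (Space (m + 1))
  inner_axis : ⟪basis 0, basis 0⟫ = 1
  inner_axis_edge : ∀ i : Fin m, ⟪basis 0, basis i.succ⟫ = 0
  inner_edges : ∀ i j : Fin m, ⟪basis i.succ, basis j.succ⟫ = if i = j then 4 else 3

theorem exists_frame (m : ℕ) : Nonempty (Frame m) := by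
  -- Since `(1 + s J)² = 1 + (2 s + m s²) J`, this makes `1 + s J` a square root of the Gram matrix;
  -- its rows give the edge vectors.
  obtain ⟨s, hs⟩ : ∃ s : ℝ, 2 * s + m * s ^ 2 = 3 := by
    rcases Nat.eq_zero_or_pos m with rfl | hm
    · exact ⟨3 / 2, by norm_num⟩
    · have hm' : (0 : ℝ) < m := by exact_mod_cast hm
      have h := Real.sq_sqrt (show (0 : ℝ) ≤ 1 + 3 * m by positivity)
      refine ⟨(√(1 + 3 * m) - 1) / m, ?_⟩
      field_simp
      nlinarith
  let u : Space (m + 1) := ∑ j : Fin m, EuclideanSpace.single j.succ (1 : ℝ)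
  let v : Fin (m + 1) → Space (m + 1) :=
    Fin.cons (EuclideanSpace.single 0 1) fun i => EuclideanSpace.single i.succ (1 : ℝ) + s • u
  have hsu : ∀ i : Fin m, ⟪EuclideanSpace.single i.succ (1 : ℝ), u⟫ = 1 := fun i => by
    simp [u, inner_sum, EuclideanSpace.inner_single_left, EuclideanSpace.single]
  have hus : ∀ i : Fin m, ⟪u, EuclideanSpace.single i.succ (1 : ℝ)⟫ = 1 := fun i => by
    rw [real_inner_comm, hsu]
  have huu : ⟪u, u⟫ = m := by
    have h : ⟪u, u⟫ = ∑ j : Fin m, ⟪u, EuclideanSpace.single j.succ (1 : ℝ)⟫ := inner_sum _ _ _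
    rw [h]
    simp [hus]
  have h0u : ⟪EuclideanSpace.single (0 : Fin (m + 1)) (1 : ℝ), u⟫ = 0 := by
    simp [u, inner_sum, EuclideanSpace.inner_single_left, EuclideanSpace.single]
  have h00 : ⟪v 0, v 0⟫ = 1 := by simp [v]
  have h0 : ∀ i : Fin m, ⟪v 0, v i.succ⟫ = 0 := fun i => by
    simp only [v, Fin.cons_zero, Fin.cons_succ, inner_add_right, inner_smul_right, h0u]
    simp [EuclideanSpace.inner_single_left, (Fin.succ_ne_zero i).symm]
  have hv : ∀ i j : Fin m, ⟪v i.succ, v j.succ⟫ = if i = j then 4 else 3 := fun i j => by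
    simp only [v, Fin.cons_succ, inner_add_right, inner_add_left, inner_smul_right,
      inner_smul_left, hsu, hus, huu]
    by_cases hij : i = j
    · simp [hij]
      linarith
    · simp [hij, EuclideanSpace.inner_single_left]
      linarith
  have hli : LinearIndependent ℝ v := by
    rw [Fintype.linearIndependent_iff]
    intro a ha
    have key : ∀ w, ∑ i, a i * ⟪w, v i⟫ = 0 := fun w => by
      have := congrArg (fun z => ⟪w, z⟫) ha
      simpa [inner_sum, inner_smul_right] using this
    have k0 : a 0 = 0 := by
      have := key (v 0)
      rw [Fin.sum_univ_succ, h00] at this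
      simpa [h0] using this
    have k1 : ∀ i : Fin m, a i.succ + 3 * ∑ j : Fin m, a j.succ = 0 := fun i => by
      have := key (v i.succ)
      rw [Fin.sum_univ_succ, k0] at this
      have e : ∀ j : Fin m, a j.succ * (if i = j then (4 : ℝ) else 3) =
          (if i = j then a j.succ else 0) + 3 * a j.succ := fun j => by split_ifs <;> ring
      simp only [hv, e, Finset.sum_add_distrib, ← Finset.mul_sum] at this
      simpa using this
    have k2 : ∑ j : Fin m, a j.succ = 0 := by
      have := Finset.sum_congr rfl fun (i : Fin m) (_ : i ∈ Finset.univ) => k1 i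
      rw [Finset.sum_add_distrib] at this
      simp at this
      have h3 : (1 + 3 * (m : ℝ)) * ∑ j : Fin m, a j.succ = 0 := by linarith
      exact (mul_eq_zero.1 h3).resolve_left (by positivity)
    intro i
    refine Fin.cases k0 (fun j => ?_) i
    have := k1 j
    rw [k2] at this
    linarith
  refine ⟨⟨basisOfLinearIndependentOfCardEqFinrank hli (by simp), ?_, ?_, ?_⟩⟩
  · simpa using h00
  · simpa using h0
  · simpa using hv

namespace Frame

variable {m : ℕ} (B : Frame m)

/-- The unit vector along which the layers are stacked. -/
noncomputable def axis : Space (m + 1) := B.basis 0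

/-- The edge vectors of the cells that are orthogonal to the axis. -/
noncomputable def edge (i : Fin m) : Space (m + 1) := B.basis i.succ

/-- The coordinates with respect to the basis. -/
noncomputable def coord : Space (m + 1) ≃ₗ[ℝ] (Fin (m + 1) → ℝ) := B.basis.equivFun

theorem coord_basis (i j : Fin (m + 1)) : B.coord (B.basis i) j = if i = j then 1 else 0 :=
  B.basis.equivFun_self i j

@[simp] theorem coord_axis_zero : B.coord B.axis 0 = 1 := by simp [axis, coord_basis]

@[simp] theorem coord_axis_succ (i : Fin m) : B.coord B.axis i.succ = 0 := by
  rw [axis, coord_basis, if_neg (Fin.succ_ne_zero i).symm]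

@[simp] theorem coord_edge_zero (i : Fin m) : B.coord (B.edge i) 0 = 0 := by
  rw [edge, coord_basis, if_neg (Fin.succ_ne_zero i)]

@[simp] theorem coord_edge_succ (i j : Fin m) :
    B.coord (B.edge i) j.succ = if i = j then 1 else 0 := by
  simp [edge, coord_basis, Fin.succ_inj]

theorem inner_axis_axis : ⟪B.axis, B.axis⟫ = 1 := B.inner_axis

theorem inner_axis_edge' (i : Fin m) : ⟪B.axis, B.edge i⟫ = 0 := B.inner_axis_edge i

theorem inner_edge_axis (i : Fin m) : ⟪B.edge i, B.axis⟫ = 0 := by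
  rw [real_inner_comm, inner_axis_edge']

theorem inner_edge_edge (i j : Fin m) : ⟪B.edge i, B.edge j⟫ = if i = j then 4 else 3 :=
  B.inner_edges i j

theorem inner_edge_self (i : Fin m) : ⟪B.edge i, B.edge i⟫ = 4 := by
  simp only [inner_edge_edge, if_true]

theorem eq_sum (x : Space (m + 1)) :
    x = B.coord x 0 • B.axis + ∑ i : Fin m, B.coord x i.succ • B.edge i := by
  have h := B.basis.sum_equivFun x
  rw [Fin.sum_univ_succ] at h
  exact h.symm

theorem inner_axis_eq (x : Space (m + 1)) : ⟪B.axis, x⟫ = B.coord x 0 := by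
  conv_lhs => rw [B.eq_sum x]
  simp only [inner_add_right, inner_smul_right, inner_sum, inner_axis_axis, inner_axis_edge']
  simp

theorem inner_edge_eq (i : Fin m) (x : Space (m + 1)) :
    ⟪B.edge i, x⟫ = B.coord x i.succ + 3 * ∑ j : Fin m, B.coord x j.succ := by
  have e : ∀ j : Fin m, B.coord x j.succ * (if i = j then (4 : ℝ) else 3) =
      (if i = j then B.coord x j.succ else 0) + 3 * B.coord x j.succ := fun j => by
    split_ifs <;> ring
  conv_lhs => rw [B.eq_sum x]
  simp only [inner_add_right, inner_smul_right, inner_sum, inner_edge_axis, inner_edge_edge, e,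
    Finset.sum_add_distrib, ← Finset.mul_sum]
  simp

theorem coord_ext {x y : Space (m + 1)} (h0 : B.coord x 0 = B.coord y 0)
    (h : ∀ i : Fin m, B.coord x i.succ = B.coord y i.succ) : x = y :=
  B.coord.injective (funext fun i => Fin.cases h0 h i)

/-- The reflection of the space that reverses the axis. -/
noncomputable def axisFlip : Space (m + 1) ≃ₗᵢ[ℝ] Space (m + 1) := hyperplaneReflection B.axis

/-- The linear isometry that fixes the axis and reverses its orthogonal complement. -/
noncomputable def planeFlip : Space (m + 1) ≃ₗᵢ[ℝ] Space (m + 1) := (ℝ ∙ B.axis).reflection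

/-- The reflection that exchanges two edge vectors. -/
noncomputable def edgeSwap (i j : Fin m) : Space (m + 1) ≃ₗᵢ[ℝ] Space (m + 1) :=
  hyperplaneReflection (B.edge i - B.edge j)

/-- The linear reflection in the hyperplane orthogonal to an edge vector. -/
noncomputable def edgeFlip (i : Fin m) : Space (m + 1) ≃ₗᵢ[ℝ] Space (m + 1) :=
  hyperplaneReflection (B.edge i)

theorem axisFlip_apply (x : Space (m + 1)) : B.axisFlip x = x - (2 * B.coord x 0) • B.axis := by
  rw [axisFlip, hyperplaneReflection_apply, inner_axis_axis, inner_axis_eq, div_one]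

theorem planeFlip_apply (x : Space (m + 1)) : B.planeFlip x = (2 * B.coord x 0) • B.axis - x := by
  have h := B.axisFlip_apply x
  rw [axisFlip, hyperplaneReflection, Submodule.reflection_orthogonal_apply, neg_eq_iff_eq_neg,
    neg_sub] at h
  exact h

theorem edgeFlip_apply (i : Fin m) (x : Space (m + 1)) :
    B.edgeFlip i x = x - (⟪B.edge i, x⟫ / 2) • B.edge i := by
  rw [edgeFlip, hyperplaneReflection_apply, inner_edge_self]
  congr 2
  ring

theorem edgeSwap_self (i : Fin m) (x : Space (m + 1)) : B.edgeSwap i i x = x := by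
  rw [edgeSwap, hyperplaneReflection_apply, sub_self, smul_zero, sub_zero]

theorem edgeSwap_apply {i j : Fin m} (hij : i ≠ j) (x : Space (m + 1)) :
    B.edgeSwap i j x =
      x - (B.coord x i.succ - B.coord x j.succ) • (B.edge i - B.edge j) := by
  rw [edgeSwap, hyperplaneReflection_apply]
  congr 2
  have h1 : ⟪B.edge i - B.edge j, x⟫ = B.coord x i.succ - B.coord x j.succ := by
    rw [inner_sub_left, inner_edge_eq, inner_edge_eq]
    ring
  have h2 : ⟪B.edge i - B.edge j, B.edge i - B.edge j⟫ = 2 := by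
    simp only [inner_sub_left, inner_sub_right, inner_edge_edge, if_true, if_neg hij,
      if_neg hij.symm]
    norm_num
  rw [h1, h2]
  ring

@[simp] theorem coord_axisFlip_zero (x : Space (m + 1)) :
    B.coord (B.axisFlip x) 0 = -B.coord x 0 := by
  rw [axisFlip_apply]
  simp
  ring

@[simp] theorem coord_axisFlip_succ (x : Space (m + 1)) (i : Fin m) :
    B.coord (B.axisFlip x) i.succ = B.coord x i.succ := by
  simp [axisFlip_apply]

@[simp] theorem coord_planeFlip_zero (x : Space (m + 1)) :
    B.coord (B.planeFlip x) 0 = B.coord x 0 := by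
  rw [planeFlip_apply]
  simp
  ring

@[simp] theorem coord_planeFlip_succ (x : Space (m + 1)) (i : Fin m) :
    B.coord (B.planeFlip x) i.succ = -B.coord x i.succ := by
  simp [planeFlip_apply]

@[simp] theorem coord_edgeSwap_zero (i j : Fin m) (x : Space (m + 1)) :
    B.coord (B.edgeSwap i j x) 0 = B.coord x 0 := by
  rcases eq_or_ne i j with rfl | hij
  · rw [edgeSwap_self]
  · simp [edgeSwap_apply B hij]

@[simp] theorem coord_edgeSwap_succ (i j k : Fin m) (x : Space (m + 1)) :
    B.coord (B.edgeSwap i j x) k.succ = B.coord x (Equiv.swap i j k).succ := by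
  rcases eq_or_ne i j with rfl | hij
  · rw [edgeSwap_self, Equiv.swap_self, Equiv.refl_apply]
  · rw [edgeSwap_apply B hij, Equiv.swap_apply_def]
    rcases eq_or_ne k i with rfl | hki
    · simp [hij.symm]
    · rcases eq_or_ne k j with rfl | hkj
      · simp [hij, hij.symm]
      · simp [hki, hkj, hki.symm, hkj.symm]

theorem edgeSwap_edge (i j k : Fin m) : B.edgeSwap i j (B.edge k) = B.edge (Equiv.swap i j k) :=
  B.coord_ext (by simp) fun l => by
    simp [Equiv.swap_apply_eq_iff, eq_comm (a := k)]

/-! ### Cells, layers and the symmetries of a layer -/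

/-- The box of all points whose coordinates lie between those of `c` and those of `c + 1`. -/
def cell (c : Fin (m + 1) → ℤ) : Set (Space (m + 1)) :=
  {x | ∀ i, B.coord x i ∈ Set.Icc (c i : ℝ) (c i + 1)}

/-- The cells between the heights `n` and `n + 1`. -/
def layer (n : ℤ) : Set (Set (Space (m + 1))) := B.cell '' {c | c 0 = n}

theorem cell_le {c c' : Fin (m + 1) → ℤ} {t : Fin (m + 1) → ℝ}
    (h : ∀ x ∈ B.cell c, ∀ i, (c' i : ℝ) ≤ B.coord x i + t i) (i : Fin (m + 1)) :
    (c' i : ℝ) ≤ c i + t i := by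
  simpa using h (B.coord.symm fun i => c i) (fun i => by simp) i

theorem le_cell {c c' : Fin (m + 1) → ℤ} {t : Fin (m + 1) → ℝ}
    (h : ∀ x ∈ B.cell c, ∀ i, B.coord x i + t i ≤ (c' i : ℝ) + 1) (i : Fin (m + 1)) :
    c i + t i ≤ (c' i : ℝ) := by
  have := h (B.coord.symm fun i => c i + 1) (fun i => by simp) i
  simp at this
  linarith

/-- Translation vectors between cells are lattice vectors. -/
theorem coord_of_translation_smul_cell {c c' : Fin (m + 1) → ℤ} {v : Space (m + 1)}
    (h : translation v • B.cell c = B.cell c') (i : Fin (m + 1)) :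
    B.coord v i = c' i - c i := by
  have key : ∀ x ∈ B.cell c, ∀ i, B.coord x i + B.coord v i ∈ Set.Icc (c' i : ℝ) (c' i + 1) := by
    intro x hx i
    have : translation v • x ∈ B.cell c' := h ▸ Set.smul_mem_smul_set hx
    simpa [add_comm] using this i
  have h1 := B.cell_le (t := B.coord v) (fun x hx i => (key x hx i).1) i
  have h2 := B.le_cell (t := B.coord v) (fun x hx i => (key x hx i).2) i
  linarith

theorem smul_cell_eq {g : Space (m + 1) ≃ᵃⁱ[ℝ] Space (m + 1)} {c c' : Fin (m + 1) → ℤ}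
    (h : ∀ x, g • x ∈ B.cell c' ↔ x ∈ B.cell c) : g • B.cell c = B.cell c' := by
  ext x
  rw [Set.mem_smul_set_iff_inv_smul_mem, ← h, smul_inv_smul]

theorem smul_layer_subset {g : Space (m + 1) ≃ᵃⁱ[ℝ] Space (m + 1)} {n k : ℤ}
    (h : ∀ c : Fin (m + 1) → ℤ, c 0 = n → ∃ c' : Fin (m + 1) → ℤ, c' 0 = k ∧
      ∀ x, g • x ∈ B.cell c' ↔ x ∈ B.cell c) : g • B.layer n ⊆ B.layer k := by
  rintro _ ⟨_, ⟨c, hc, rfl⟩, rfl⟩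
  obtain ⟨c', hc', h'⟩ := h c hc
  exact ⟨c', hc', (B.smul_cell_eq h').symm⟩

theorem translation_inv {d : ℕ} (v : Space d) : (translation v)⁻¹ = translation (-v) := by
  rw [inv_eq_iff_mul_eq_one]
  exact affineIsometry_ext fun x => by simp [mul_smul]

theorem translation_smul_mem_cell {v : Space (m + 1)} {a : Fin (m + 1) → ℤ}
    (ha : ∀ i, B.coord v i = a i) (c : Fin (m + 1) → ℤ) (x : Space (m + 1)) :
    translation v • x ∈ B.cell (c + a) ↔ x ∈ B.cell c := by
  refine forall_congr' fun i => ?_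
  simp only [translation_smul, map_add, Pi.add_apply, ha, Set.mem_Icc, Int.cast_add]
  constructor <;> rintro ⟨h1, h2⟩ <;> constructor <;> linarith

theorem translation_smul_layer {v : Space (m + 1)} {a : Fin (m + 1) → ℤ}
    (ha : ∀ i, B.coord v i = a i) (n : ℤ) :
    translation v • B.layer n = B.layer (n + a 0) := by
  refine Set.Subset.antisymm (B.smul_layer_subset fun c hc => ⟨c + a, by simp [hc], ?_⟩) ?_
  · exact B.translation_smul_mem_cell ha c
  · rw [Set.subset_smul_set_iff, translation_inv]
    refine B.smul_layer_subset fun c hc => ⟨c + -a, by simp [hc], ?_⟩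
    exact B.translation_smul_mem_cell (fun i => by simp [ha]) c

theorem smul_layer_of_involution {g : Space (m + 1) ≃ᵃⁱ[ℝ] Space (m + 1)} {n k : ℤ} (hg : g⁻¹ = g)
    (h1 : g • B.layer n ⊆ B.layer k) (h2 : g • B.layer k ⊆ B.layer n) :
    g • B.layer n = B.layer k :=
  Set.Subset.antisymm h1 (by rwa [Set.subset_smul_set_iff, hg])

theorem linear_inv_of_involutive {d : ℕ} {R : Space d ≃ₗᵢ[ℝ] Space d} (h : ∀ x, R (R x) = x) :
    (linear R)⁻¹ = linear R := by
  rw [inv_eq_iff_mul_eq_one]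
  exact affineIsometry_ext fun x => by simp [mul_smul, h]

theorem axisFlip_smul_layer (n : ℤ) : linear B.axisFlip • B.layer n = B.layer (-1 - n) := by
  have key : ∀ n, linear B.axisFlip • B.layer n ⊆ B.layer (-1 - n) := fun n =>
    B.smul_layer_subset fun c hc =>
      ⟨Fin.cons (-1 - n) fun i => c i.succ, by simp, fun x => by
        simp only [cell, Set.mem_ofPred_eq, Fin.forall_fin_succ, linear_smul, coord_axisFlip_zero,
          coord_axisFlip_succ, Fin.cons_zero, Fin.cons_succ, hc]
        refine and_congr_left fun _ => ?_
        simp only [Set.mem_Icc]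
        push_cast
        constructor <;> rintro ⟨h1, h2⟩ <;> constructor <;> linarith⟩
  refine B.smul_layer_of_involution (linear_inv_of_involutive ?_) (key n) ?_
  · exact Submodule.reflection_reflection _
  · simpa using key (-1 - n)

theorem planeFlip_smul_layer (n : ℤ) : linear B.planeFlip • B.layer n = B.layer n := by
  have key : linear B.planeFlip • B.layer n ⊆ B.layer n :=
    B.smul_layer_subset fun c hc =>
      ⟨Fin.cons n fun i => -1 - c i.succ, by simp, fun x => by
        simp only [cell, Set.mem_ofPred_eq, Fin.forall_fin_succ, linear_smul, coord_planeFlip_zero,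
          coord_planeFlip_succ, Fin.cons_zero, Fin.cons_succ, hc]
        refine and_congr_right fun _ => forall_congr' fun i => ?_
        simp only [Set.mem_Icc]
        push_cast
        constructor <;> rintro ⟨h1, h2⟩ <;> constructor <;> linarith⟩
  exact B.smul_layer_of_involution
    (linear_inv_of_involutive (Submodule.reflection_reflection _)) key key

theorem edgeSwap_smul_layer (i j : Fin m) (n : ℤ) :
    linear (B.edgeSwap i j) • B.layer n = B.layer n := by
  have key : linear (B.edgeSwap i j) • B.layer n ⊆ B.layer n :=
    B.smul_layer_subset fun c hc =>
      ⟨Fin.cons n fun k => c (Equiv.swap i j k).succ, by simp, fun x => by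
        simp only [cell, Set.mem_ofPred_eq, Fin.forall_fin_succ, linear_smul, coord_edgeSwap_zero,
          coord_edgeSwap_succ, Fin.cons_zero, Fin.cons_succ, hc]
        refine and_congr_right fun _ => ?_
        exact (Equiv.swap i j).forall_congr_right (q := fun k : Fin m =>
          B.coord x k.succ ∈ Set.Icc (c k.succ : ℝ) (c k.succ + 1))⟩
  exact B.smul_layer_of_involution
    (linear_inv_of_involutive (Submodule.reflection_reflection _)) key key

/-! ### Mirrors and their commutation relations -/

/-- The reflection in the hyperplane of all points whose inner product with an edge vector is
`1 / 2`. -/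
noncomputable def mirror (i : Fin m) : Space (m + 1) ≃ᵃⁱ[ℝ] Space (m + 1) :=
  translation ((1 / 4 : ℝ) • B.edge i) * linear (B.edgeFlip i)

theorem mirror_smul (i : Fin m) (x : Space (m + 1)) :
    B.mirror i • x = x - ((⟪B.edge i, x⟫ - 1 / 2) / 2) • B.edge i := by
  rw [mirror, mul_smul, translation_smul, linear_smul, edgeFlip_apply]
  module

theorem mirror_mul_self (i : Fin m) : B.mirror i * B.mirror i = 1 :=
  affineIsometry_ext fun x => by
    rw [mul_smul, mirror_smul, mirror_smul, one_smul, inner_sub_right, inner_smul_right,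
      inner_edge_self]
    module

theorem mirror_inv (i : Fin m) : (B.mirror i)⁻¹ = B.mirror i :=
  inv_eq_of_mul_eq_one_left (B.mirror_mul_self i)

theorem coord_mirror_zero (i : Fin m) (x : Space (m + 1)) :
    B.coord (B.mirror i • x) 0 = B.coord x 0 := by
  simp [mirror_smul]

theorem mirror_mul_translation (i : Fin m) (v : Space (m + 1)) :
    B.mirror i * translation v = translation (B.edgeFlip i v) * B.mirror i :=
  affineIsometry_ext fun x => by
    simp only [mul_smul, mirror_smul, translation_smul, edgeFlip_apply, inner_add_right]
    module

theorem mirror_mul_axisFlip (i : Fin m) :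
    B.mirror i * linear B.axisFlip = linear B.axisFlip * B.mirror i :=
  affineIsometry_ext fun x => by
    simp only [mul_smul, mirror_smul, linear_smul, axisFlip_apply, inner_sub_right,
      inner_smul_right, inner_edge_axis, map_sub, map_smul, coord_edge_zero]
    module

/-- The mirror moves `0` to a quarter of the edge, so it conjugates the flip about the axis into the
flip about a parallel axis through that point. The resulting half edge is what compensates odd inner
products in `exists_smul_pair_eq_smul_zero_eq`. -/
theorem mirror_mul_planeFlip (i : Fin m) :
    B.mirror i * linear B.planeFlip =
      translation ((1 / 2 : ℝ) • B.edge i) * linear B.planeFlip * B.mirror i :=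
  affineIsometry_ext fun x => by
    simp only [mul_smul, mirror_smul, linear_smul, translation_smul, planeFlip_apply,
      inner_sub_right, inner_smul_right, inner_edge_axis, map_sub, map_smul, coord_edge_zero]
    module

theorem edgeSwap_mul_mirror (i j k : Fin m) :
    linear (B.edgeSwap i j) * B.mirror k =
      B.mirror (Equiv.swap i j k) * linear (B.edgeSwap i j) :=
  affineIsometry_ext fun x => by
    rw [mul_smul, mul_smul, mirror_smul, mirror_smul, linear_smul, linear_smul, map_sub, map_smul,
      edgeSwap_edge, ← B.edgeSwap_edge i j k, LinearIsometryEquiv.inner_map_map]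

/-! ### The tiling -/

/-- The isometries carrying the standard layers to the layers of the tiling. -/
noncomputable def stack (s : ℕ → Fin m) : ℕ → (Space (m + 1) ≃ᵃⁱ[ℝ] Space (m + 1))
  | 0 => 1
  | n + 1 => stack s n * B.mirror (s n)

/-- The tile with label `c`. -/
noncomputable def tile (s : ℕ → Fin m) (c : Fin (m + 1) → ℤ) : Set (Space (m + 1)) :=
  B.stack s (c 0).natAbs • B.cell c

/-- The tiling whose layers at heights `n` and `-n` are both obtained from the standard layers by
the first `n` mirrors of the sequence `s`. -/
noncomputable def tiling (s : ℕ → Fin m) : Set (Set (Space (m + 1))) :=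
  Set.range (B.tile s)

theorem coord_stack_zero (s : ℕ → Fin m) (n : ℕ) (x : Space (m + 1)) :
    B.coord (B.stack s n • x) 0 = B.coord x 0 := by
  induction n generalizing x with
  | zero => rw [stack, one_smul]
  | succ n ih => rw [stack, mul_smul, ih, coord_mirror_zero]

theorem coord_stack_inv_zero (s : ℕ → Fin m) (n : ℕ) (x : Space (m + 1)) :
    B.coord ((B.stack s n)⁻¹ • x) 0 = B.coord x 0 := by
  rw [← B.coord_stack_zero s n, smul_inv_smul]

theorem height_mem_of_mem_tile {s : ℕ → Fin m} {c : Fin (m + 1) → ℤ} {x : Space (m + 1)}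
    (hx : x ∈ B.tile s c) : B.coord x 0 ∈ Set.Icc (c 0 : ℝ) (c 0 + 1) := by
  obtain ⟨y, hy, rfl⟩ := hx
  have := hy 0
  rwa [← B.coord_stack_zero s (c 0).natAbs] at this

theorem cell_eq_preimage (c : Fin (m + 1) → ℤ) :
    B.cell c = B.coord.toContinuousLinearEquiv.toHomeomorph ⁻¹'
      Set.univ.pi fun i => Set.Icc (c i : ℝ) (c i + 1) := by
  ext x
  exact ⟨fun h i _ => h i, fun h i => h i (Set.mem_univ i)⟩

theorem interior_cell (c : Fin (m + 1) → ℤ) :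
    interior (B.cell c) = {x | ∀ i, B.coord x i ∈ Set.Ioo (c i : ℝ) (c i + 1)} := by
  rw [cell_eq_preimage, ← Homeomorph.preimage_interior, interior_pi_set Set.finite_univ]
  ext x
  simp

/-- The points whose coordinates are those of the corners of a cell. -/
def corners (c : Fin (m + 1) → ℤ) : Set (Space (m + 1)) :=
  B.coord.symm '' Set.univ.pi fun i => {(c i : ℝ), (c i + 1 : ℝ)}

theorem finite_corners (c : Fin (m + 1) → ℤ) : (B.corners c).Finite :=
  (Set.Finite.pi fun _ => Set.toFinite _).image _

theorem convexHull_corners (c : Fin (m + 1) → ℤ) : convexHull ℝ (B.corners c) = B.cell c := by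
  have h : B.corners c = (B.coord.symm : (Fin (m + 1) → ℝ) →ₗ[ℝ] Space (m + 1)) ''
    Set.univ.pi fun i => {(c i : ℝ), (c i + 1 : ℝ)} := rfl
  rw [h, ← LinearMap.image_convexHull, convexHull_pi]
  ext x
  have e : ∀ i, convexHull ℝ {(c i : ℝ), (c i + 1 : ℝ)} = Set.Icc (c i : ℝ) (c i + 1) := fun i => by
    rw [convexHull_pair, segment_eq_Icc (by linarith)]
  simp only [e]
  constructor
  · rintro ⟨y, hy, rfl⟩ i
    simpa using hy i (Set.mem_univ i)
  · exact fun hx => ⟨B.coord x, fun i _ => hx i, by simp⟩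

theorem mem_corners {c : Fin (m + 1) → ℤ} {x : Space (m + 1)} (hx : x ∈ B.corners c)
    (i : Fin (m + 1)) : B.coord x i = c i ∨ B.coord x i = c i + 1 := by
  obtain ⟨y, hy, rfl⟩ := hx
  simpa using hy i (Set.mem_univ i)

theorem smul_convexHull {d : ℕ} (g : Space d ≃ᵃⁱ[ℝ] Space d) (S : Set (Space d)) :
    g • convexHull ℝ S = convexHull ℝ (g • S) :=
  AffineMap.image_convexHull (g.toAffineEquiv : Space d →ᵃ[ℝ] Space d) S

theorem tile_eq_convexHull (s : ℕ → Fin m) (c : Fin (m + 1) → ℤ) :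
    B.tile s c = convexHull ℝ (B.stack s (c 0).natAbs • B.corners c) := by
  rw [tile, ← convexHull_corners, smul_convexHull]

theorem smul_interior {d : ℕ} (g : Space d ≃ᵃⁱ[ℝ] Space d) (S : Set (Space d)) :
    g • interior S = interior (g • S) :=
  g.toHomeomorph.image_interior S

theorem interior_tile (s : ℕ → Fin m) (c : Fin (m + 1) → ℤ) :
    interior (B.tile s c) = B.stack s (c 0).natAbs • interior (B.cell c) :=
  (smul_interior _ _).symm

theorem isConvexPolytope_tile (s : ℕ → Fin m) (c : Fin (m + 1) → ℤ) :
    IsConvexPolytope (B.tile s c) := by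
  refine ⟨⟨((B.finite_corners c).image (B.stack s (c 0).natAbs • ·)).toFinset, ?_⟩, ?_⟩
  · rw [Set.Finite.coe_toFinset, Set.image_smul, tile_eq_convexHull]
  · rw [interior_tile, interior_cell, Set.smul_set_nonempty]
    exact ⟨B.coord.symm fun i => c i + 1 / 2, fun i => by norm_num⟩

theorem isTiling_tiling (s : ℕ → Fin m) : IsTiling (B.tiling s) where
  countable := Set.countable_range _
  isCompact := by
    rintro _ ⟨c, rfl⟩
    obtain ⟨V, hV⟩ := (B.isConvexPolytope_tile s c).1
    rw [hV]
    exact V.finite_toSet.isCompact_convexHull ℝ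
  covering := by
    refine Set.eq_univ_of_forall fun x => ?_
    let y := (B.stack s ⌊B.coord x 0⌋.natAbs)⁻¹ • x
    have hy : B.coord y 0 = B.coord x 0 := B.coord_stack_inv_zero _ _ _
    refine ⟨_, ⟨fun i => ⌊B.coord y i⌋, rfl⟩, ?_⟩
    rw [tile, Set.mem_smul_set_iff_inv_smul_mem, hy]
    exact fun i => ⟨Int.floor_le _, (Int.lt_floor_add_one _).le⟩
  packing := by
    rintro _ ⟨c, rfl⟩ _ ⟨c', rfl⟩ hne
    rw [← Set.not_nonempty_iff_eq_empty]
    rintro ⟨x, hx, hx'⟩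
    apply hne
    rw [interior_tile, Set.mem_smul_set_iff_inv_smul_mem, interior_cell] at hx hx'
    have floor_eq : ∀ {r : ℝ} {k l : ℤ}, r ∈ Set.Ioo (k : ℝ) (k + 1) →
        r ∈ Set.Ioo (l : ℝ) (l + 1) → k = l := fun {r k l} h h' => by
      rw [← Int.floor_eq_iff.2 ⟨h.1.le, h.2⟩, ← Int.floor_eq_iff.2 ⟨h'.1.le, h'.2⟩]
    -- Mirrors preserve heights, so overlapping tiles lie in the same layer and are images of cells
    -- under the same isometry.
    have h0 : c 0 = c' 0 := by
      have h := hx 0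
      have h' := hx' 0
      rw [coord_stack_inv_zero] at h h'
      exact floor_eq h h'
    rw [← h0] at hx'
    rw [funext fun i => floor_eq (hx i) (hx' i)]

theorem isPolytopeTiling_tiling (s : ℕ → Fin m) : IsPolytopeTiling (B.tiling s) := by
  refine ⟨B.isTiling_tiling s, ?_⟩
  rintro _ ⟨c, rfl⟩
  exact B.isConvexPolytope_tile s c

/-- The vertices of the tiling in terms of the cells. -/
theorem exists_of_isVertex {s : ℕ → Fin m} {x : Space (m + 1)} (hx : IsVertex (B.tiling s) x) :
    ∃ (c : Fin (m + 1) → ℤ) (y : Space (m + 1)), x = B.stack s (c 0).natAbs • y ∧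
      y ∈ B.corners c := by
  obtain ⟨_, ⟨c, rfl⟩, hx⟩ := hx
  rw [tile_eq_convexHull] at hx
  obtain ⟨y, hy, rfl⟩ := extremePoints_convexHull_subset hx
  exact ⟨c, y, rfl, hy⟩

/-- Two tiles of layer 1 are chosen whose traces on `cell 0` meet only in `axis + edge / 4`. If both
traces were faces, so would be this point, but a coordinate `1 / 4` is not that of a corner. -/
theorem not_isFaceToFace_tiling (s : ℕ → Fin m) : ¬ IsFaceToFace (B.tiling s) := by
  intro hF
  let i := s 0
  let c (k : ℤ) : Fin (m + 1) → ℤ := Fin.cons 1 fun _ => k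
  let x : Space (m + 1) := B.mirror i • B.axis
  have hx : x = B.axis + (1 / 4 : ℝ) • B.edge i := by
    simp only [x, mirror_smul, inner_edge_axis]
    module
  have htile0 : B.tile s 0 = B.cell 0 := by
    simp [tile, stack]
  have htile : ∀ k, B.tile s (c k) = B.mirror i • B.cell (c k) := fun k => by
    simp [tile, c, stack, i]
  have hxS : x ∈ B.cell 0 := by
    intro j
    rw [hx]
    refine Fin.cases ?_ (fun l => ?_) j
    · simp
    · by_cases h : i = l
      · simp [h]
        norm_num
      · simp [h]
  have hxT : ∀ k : ℤ, k = 0 ∨ k = -1 → x ∈ B.mirror i • B.cell (c k) := fun k hk => by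
    refine Set.smul_mem_smul_set fun j => Fin.cases ?_ (fun l => ?_) j
    · simp [c]
    · rcases hk with rfl | rfl <;> simp [c]
  have hinter : B.cell 0 ∩ (B.mirror i • B.cell (c 0)) ∩ (B.cell 0 ∩ (B.mirror i • B.cell (c (-1))))
      = {x} := by
    refine Set.Subset.antisymm ?_ ?_
    · rintro y ⟨⟨hy0, hy1⟩, -, hy2⟩
      rw [Set.mem_smul_set_iff_inv_smul_mem] at hy1 hy2
      rw [Set.mem_singleton_iff, ← inv_smul_eq_iff]
      refine B.coord_ext ?_ fun l => ?_
      · have h1 := (hy1 0).1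
        have h0 := (hy0 0).2
        rw [← B.coord_mirror_zero i, smul_inv_smul] at h1 ⊢
        simp [c] at h0 h1 ⊢
        linarith
      · have h1 := (hy1 l.succ).1
        have h2 := (hy2 l.succ).2
        simp [c] at h1 h2 ⊢
        linarith
    · rintro _ rfl
      exact ⟨⟨hxS, hxT 0 (Or.inl rfl)⟩, hxS, hxT (-1) (Or.inr rfl)⟩
  have hface : ∀ k, IsExposed ℝ (B.cell 0) (B.cell 0 ∩ (B.mirror i • B.cell (c k))) := fun k => by
    have := (hF _ ⟨0, rfl⟩ _ ⟨c k, rfl⟩).1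
    rwa [htile0, htile] at this
  have hexp := (hface 0).inter (hface (-1))
  rw [hinter] at hexp
  have hext := exposedPoints_subset_extremePoints (mem_exposedPoints_iff_exposed_singleton.2 hexp)
  rw [← convexHull_corners] at hext
  have := B.mem_corners (extremePoints_convexHull_subset hext) i.succ
  rw [hx] at this
  norm_num at this

/-! ### Monocoronality -/

/-- The lattice generated by the edge vectors. -/
def lattice : AddSubgroup (Space (m + 1)) where
  carrier := {x | ∃ a : Fin (m + 1) → ℤ, a 0 = 0 ∧ ∀ i, B.coord x i = a i}
  zero_mem' := ⟨0, rfl, fun i => by simp⟩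
  add_mem' := by
    rintro x y ⟨a, ha, hx⟩ ⟨b, hb, hy⟩
    exact ⟨a + b, by simp [ha, hb], fun i => by simp [hx, hy]⟩
  neg_mem' := by
    rintro x ⟨a, ha, hx⟩
    exact ⟨-a, by simp [ha], fun i => by simp [hx]⟩

theorem edge_mem_lattice (i : Fin m) : B.edge i ∈ B.lattice :=
  ⟨Fin.cons 0 (Pi.single i 1), rfl, fun j => Fin.cases (by simp) (fun l => by
    simp [Pi.single_apply, eq_comm (a := i)]) j⟩

theorem exists_inner_eq_intCast {x : Space (m + 1)} (hx : x ∈ B.lattice) (i : Fin m) :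
    ∃ k : ℤ, ⟪B.edge i, x⟫ = k := by
  obtain ⟨a, -, ha⟩ := hx
  refine ⟨a i.succ + 3 * ∑ j : Fin m, a j.succ, ?_⟩
  rw [inner_edge_eq]
  simp [ha]

theorem translation_smul_layer_of_mem {x : Space (m + 1)} (hx : x ∈ B.lattice) (n : ℤ) :
    translation x • B.layer n = B.layer n := by
  obtain ⟨a, h0, ha⟩ := hx
  rw [B.translation_smul_layer ha, h0, add_zero]

/-- Two adjacent layers, related by a mirror. -/
noncomputable def pair (i : Fin m) : Set (Set (Space (m + 1))) :=
  B.layer (-1) ∪ B.mirror i • B.layer 0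

theorem smul_pair_eq {g h : Space (m + 1) ≃ᵃⁱ[ℝ] Space (m + 1)} {i j : Fin m}
    (hg : g • B.layer (-1) = B.layer (-1)) (hh : h • B.layer 0 = B.layer 0)
    (hc : g * B.mirror i = B.mirror j * h) : g • B.pair i = B.pair j := by
  rw [pair, Set.smul_set_union, hg, smul_smul, hc, mul_smul, hh, pair]

theorem edgeSwap_smul_pair (j k i : Fin m) :
    linear (B.edgeSwap j k) • B.pair i = B.pair (Equiv.swap j k i) :=
  B.smul_pair_eq (B.edgeSwap_smul_layer j k _) (B.edgeSwap_smul_layer j k _)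
    (B.edgeSwap_mul_mirror j k i)

/-- Axis reversal exchanges the two heights and commutes with the mirror, so this symmetry
interchanges the two layers of the pair. -/
theorem mirror_mul_axisFlip_smul_pair (i : Fin m) :
    (B.mirror i * linear B.axisFlip) • B.pair i = B.pair i := by
  rw [pair, Set.smul_set_union, mul_smul, axisFlip_smul_layer, smul_smul, mirror_mul_axisFlip,
    mul_assoc, mirror_mul_self, mul_one, axisFlip_smul_layer, Set.union_comm]
  norm_num

/-- The symmetries of a pair of layers act transitively on the vertices of the lower layer that lie
on the common boundary. -/
theorem exists_smul_pair_eq_smul_zero_eq (i : Fin m) {x : Space (m + 1)} (hx : x ∈ B.lattice) :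
    ∃ g : Space (m + 1) ≃ᵃⁱ[ℝ] Space (m + 1), g • B.pair i = B.pair i ∧
      g • (0 : Space (m + 1)) = x := by
  obtain ⟨k, hk⟩ := B.exists_inner_eq_intCast hx i
  have hmem : ∀ l : ℤ, x - (l : ℝ) • B.edge i ∈ B.lattice := fun l => by
    rw [Int.cast_smul_eq_zsmul]
    exact sub_mem hx (zsmul_mem (B.edge_mem_lattice i) l)
  have hflip : ∀ l : ℤ, B.edgeFlip i (x - (l : ℝ) • B.edge i) =
      x - ((k : ℝ) / 2 - l) • B.edge i := fun l => by
    rw [edgeFlip_apply, inner_sub_right, inner_smul_right, inner_edge_self, hk]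
    module
  -- The mirror turns translation by `x - l • edge` into translation by `x` if `k = 2 l`. If `k = 2
  -- l + 1`, half an edge is missing, and `planeFlip` supplies it.
  rcases Int.even_or_odd' k with ⟨l, rfl | rfl⟩
  · refine ⟨translation x, B.smul_pair_eq (B.translation_smul_layer_of_mem hx _)
      (B.translation_smul_layer_of_mem (hmem l) _) ?_, by simp⟩
    rw [mirror_mul_translation, hflip]
    congr 2
    push_cast
    module
  · refine ⟨translation x * linear B.planeFlip, B.smul_pair_eq
      (h := translation (x - (l : ℝ) • B.edge i) * linear B.planeFlip) ?_ ?_ ?_, ?_⟩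
    · rw [mul_smul, planeFlip_smul_layer, B.translation_smul_layer_of_mem hx]
    · rw [mul_smul, planeFlip_smul_layer, B.translation_smul_layer_of_mem (hmem l)]
    · rw [← mul_assoc, mirror_mul_translation, hflip, mul_assoc, mul_assoc, mirror_mul_planeFlip]
      refine affineIsometry_ext fun y => ?_
      simp only [mul_smul, translation_smul]
      generalize linear B.planeFlip • B.mirror i • y = z
      push_cast
      module
    · simp [mul_smul]

/-- The layers of the tiling that touch the height `h`. -/
noncomputable def neighbours (s : ℕ → Fin m) (h : ℤ) : Set (Set (Space (m + 1))) :=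
  B.stack s (h - 1).natAbs • B.layer (h - 1) ∪ B.stack s h.natAbs • B.layer h

/-- Below height 0, moving up removes a mirror instead of adding one; mirrors being involutions,
both kinds of interface have the same form. -/
theorem exists_stack_eq_mul_mirror (s : ℕ → Fin m) (h : ℤ) :
    ∃ i, B.stack s h.natAbs = B.stack s (h - 1).natAbs * B.mirror i := by
  rcases le_or_gt h 0 with hh | hh
  · refine ⟨s h.natAbs, ?_⟩
    rw [show (h - 1).natAbs = h.natAbs + 1 by omega, stack, mul_assoc, mirror_mul_self, mul_one]
  · refine ⟨s (h - 1).natAbs, ?_⟩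
    rw [show h.natAbs = (h - 1).natAbs + 1 by omega, stack]

theorem smul_pair_eq_neighbours {s : ℕ → Fin m} {h : ℤ} {i : Fin m}
    (hi : B.stack s h.natAbs = B.stack s (h - 1).natAbs * B.mirror i) :
    (B.stack s (h - 1).natAbs * translation ((h : ℝ) • B.axis)) • B.pair i =
      B.neighbours s h := by
  have hc : B.mirror i * translation ((h : ℝ) • B.axis) =
      translation ((h : ℝ) • B.axis) * B.mirror i := by
    rw [mirror_mul_translation, edgeFlip_apply, inner_smul_right, inner_edge_axis]
    simp
  have hl : ∀ n, translation ((h : ℝ) • B.axis) • B.layer n = B.layer (n + h) := fun n =>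
    B.translation_smul_layer (a := Fin.cons h 0)
      (fun j => Fin.cases (by simp) (fun l => by simp) j) n
  rw [pair, Set.smul_set_union, mul_smul, hl, mul_smul, smul_smul (translation _), ← hc, mul_smul,
    hl, smul_smul, ← hi, neighbours, zero_add, neg_add_eq_sub]

theorem isVertex_cases {s : ℕ → Fin m} {x : Space (m + 1)} (hx : IsVertex (B.tiling s) x) :
    ∃ (h : ℤ) (y : Space (m + 1)), y ∈ B.lattice ∧
      (x = B.stack s (h - 1).natAbs • ((h : ℝ) • B.axis + y) ∨
        x = B.stack s h.natAbs • ((h : ℝ) • B.axis + y)) := by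
  obtain ⟨c, y, rfl, hy⟩ := B.exists_of_isVertex hx
  have hcoord := B.mem_corners hy
  have hint : ∀ i, ∃ k : ℤ, B.coord y i = k := fun i => by
    rcases hcoord i with h | h
    · exact ⟨_, h⟩
    · exact ⟨c i + 1, by simp [h]⟩
  choose a ha using hint
  have hmem : y - (a 0 : ℝ) • B.axis ∈ B.lattice :=
    ⟨Fin.cons 0 fun i => a i.succ, rfl, fun i =>
      Fin.cases (by simp [ha]) (fun l => by simp [ha]) i⟩
  refine ⟨a 0, _, hmem, ?_⟩
  rw [add_sub_cancel]
  have h0 : c 0 = a 0 ∨ c 0 = a 0 - 1 := by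
    rcases hcoord 0 with h | h <;> rw [ha] at h
    · exact Or.inl (by exact_mod_cast h.symm)
    · exact Or.inr (by rw [eq_sub_iff_add_eq]; exact_mod_cast h.symm)
  rcases h0 with h | h <;> rw [h]
  · exact Or.inr rfl
  · exact Or.inl rfl

/-- The neighbourhoods of all vertices are congruent to one standard configuration. -/
theorem exists_smul_pair_of_isVertex {s : ℕ → Fin m} {x : Space (m + 1)}
    (hx : IsVertex (B.tiling s) x) (i₀ : Fin m) :
    ∃ (h : ℤ) (g : Space (m + 1) ≃ᵃⁱ[ℝ] Space (m + 1)), B.coord x 0 = h ∧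
      g • B.pair i₀ = B.neighbours s h ∧ g • (0 : Space (m + 1)) = x := by
  obtain ⟨h, y, hy, hxy⟩ := B.isVertex_cases hx
  obtain ⟨i, hi⟩ := B.exists_stack_eq_mul_mirror s h
  obtain ⟨g, hg, hg0⟩ := B.exists_smul_pair_eq_smul_zero_eq i hy
  have hy0 : B.coord y 0 = 0 := by
    obtain ⟨a, h0, ha⟩ := hy
    simp [ha, h0]
  have hflip : B.axisFlip y = y := by
    simp [axisFlip_apply, hy0]
  have hheight : B.coord x 0 = h := by
    rcases hxy with rfl | rfl <;> simp [coord_stack_zero, hy0]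
  have hswap : linear (B.edgeSwap i₀ i) • B.pair i₀ = B.pair i := by
    rw [edgeSwap_smul_pair, Equiv.swap_apply_left]
  have hswap0 : linear (B.edgeSwap i₀ i) • (0 : Space (m + 1)) = 0 := by simp
  refine ⟨h, ?_⟩
  rcases hxy with rfl | rfl
  · refine ⟨B.stack s (h - 1).natAbs * translation ((h : ℝ) • B.axis) *
      (g * linear (B.edgeSwap i₀ i)), hheight, ?_, ?_⟩
    · rw [mul_smul, mul_smul g, hswap, hg, B.smul_pair_eq_neighbours hi]
    · rw [mul_smul, mul_smul g, hswap0, hg0, mul_smul, translation_smul]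
  -- For a vertex of the upper layer, the symmetry interchanging the two layers is inserted.
  · refine ⟨B.stack s (h - 1).natAbs * translation ((h : ℝ) • B.axis) *
      (B.mirror i * linear B.axisFlip * (g * linear (B.edgeSwap i₀ i))), hheight, ?_, ?_⟩
    · rw [mul_smul, mul_smul _ (g * _), mul_smul g, hswap, hg, mirror_mul_axisFlip_smul_pair,
        B.smul_pair_eq_neighbours hi]
    · rw [mul_smul, mul_smul _ (g * _), mul_smul g, hswap0, hg0, mul_smul (B.mirror i),
        linear_smul, hflip, hi, mul_smul, mul_smul, translation_smul]
      congr 1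
      simp only [mirror_smul, inner_add_right, inner_smul_right, inner_edge_axis]
      module

/-- A point at integer height meets only the layers just below and above it, so congruence of
coronae reduces to carrying `neighbours` and the vertex. -/
theorem mem_tiling_and_mem_iff {s : ℕ → Fin m} {h : ℤ} {x : Space (m + 1)}
    (hx : B.coord x 0 = h) (T : Set (Space (m + 1))) :
    T ∈ B.tiling s ∧ x ∈ T ↔ T ∈ B.neighbours s h ∧ x ∈ T := by
  have hlayer : ∀ n : ℤ, B.stack s n.natAbs • B.layer n ⊆ B.tiling s := by
    rintro n _ ⟨_, ⟨c, rfl, rfl⟩, rfl⟩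
    exact ⟨c, rfl⟩
  refine and_congr_left fun hxT => ⟨?_, fun hT => hT.elim (hlayer _ ·) (hlayer _ ·)⟩
  rintro ⟨c, rfl⟩
  have hmem : B.tile s c ∈ B.stack s (c 0).natAbs • B.layer (c 0) :=
    Set.smul_mem_smul_set ⟨c, rfl, rfl⟩
  have hc := B.height_mem_of_mem_tile hxT
  rw [hx] at hc
  have h1 : c 0 ≤ h := by exact_mod_cast hc.1
  have h2 : h ≤ c 0 + 1 := by exact_mod_cast hc.2
  rcases (show c 0 = h ∨ c 0 = h - 1 by omega) with h' | h' <;> rw [h'] at hmem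
  · exact Or.inr hmem
  · exact Or.inl hmem

theorem carries_corona {s : ℕ → Fin m} {h k : ℤ} {x y : Space (m + 1)}
    {g : Space (m + 1) ≃ᵃⁱ[ℝ] Space (m + 1)} (hx : B.coord x 0 = h) (hy : B.coord y 0 = k)
    (hg : g • B.neighbours s h = B.neighbours s k) (hxy : g • x = y) :
    Carries g.linearIsometryEquiv (g • (0 : Space (m + 1))) (corona (B.tiling s) x)
      (corona (B.tiling s) y) := by
  have happ : ∀ p, g • (0 : Space (m + 1)) + g.linearIsometryEquiv p = g • p := fun p => by
    have := g.map_vadd 0 p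
    rw [vadd_eq_add, vadd_eq_add, add_zero] at this
    exact (add_comm _ _).trans this.symm
  refine ⟨(happ x).trans hxy, ?_⟩
  have hcor : ∀ {z : Space (m + 1)} {l : ℤ}, B.coord z 0 = l →
      (corona (B.tiling s) z).2 = {T ∈ B.neighbours s l | z ∈ T} := fun hz =>
    Set.ext fun T => B.mem_tiling_and_mem_iff hz T
  simp only [happ, hcor hx, hcor hy]
  ext T
  constructor
  · rintro ⟨S, ⟨hS, hxS⟩, rfl⟩
    exact ⟨hg ▸ Set.smul_mem_smul_set hS, hxy ▸ Set.smul_mem_smul_set hxS⟩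
  · rintro ⟨hT, hyT⟩
    rw [← hg, Set.mem_smul_set_iff_inv_smul_mem] at hT
    rw [← hxy] at hyT
    exact ⟨g⁻¹ • T, ⟨hT, by rwa [Set.mem_inv_smul_set_iff]⟩, smul_inv_smul g T⟩

theorem isMonocoronal_tiling (s : ℕ → Fin m) : IsMonocoronal (B.tiling s) := by
  intro x y hx hy
  obtain ⟨h, f, hh, hf, rfl⟩ := B.exists_smul_pair_of_isVertex hx (s 0)
  obtain ⟨k, g, hk, hg, rfl⟩ := B.exists_smul_pair_of_isVertex hy (s 0)
  refine ⟨_, _, B.carries_corona (g := g * f⁻¹) hh hk ?_ ?_⟩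
  · rw [mul_smul, ← hf, inv_smul_smul, hg]
  · rw [mul_smul, inv_smul_smul]

/-! ### Correcting the orientation -/

/-- The determinant of the linear part of an affine isometry. -/
noncomputable def linearDet {d : ℕ} : (Space d ≃ᵃⁱ[ℝ] Space d) →* ℝ where
  toFun g := LinearMap.det (g.linearIsometryEquiv.toLinearEquiv : Space d →ₗ[ℝ] Space d)
  map_one' := LinearMap.det_id
  map_mul' _ _ := LinearMap.det_comp _ _

theorem linearDet_linear_edgeSwap {i j : Fin m} (hij : i ≠ j) :
    linearDet (linear (B.edgeSwap i j)) = -1 := by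
  have hne : B.edge i - B.edge j ≠ 0 := fun h => by
    have := congrArg (fun z => B.coord z i.succ) h
    simp [hij.symm] at this
  have := (ℝ ∙ (B.edge i - B.edge j))ᗮ.det_reflection
  rw [Submodule.orthogonal_orthogonal, finrank_span_singleton hne, pow_one] at this
  exact this

theorem linearDet_eq_one_or {d : ℕ} (g : Space d ≃ᵃⁱ[ℝ] Space d) :
    linearDet g = 1 ∨ linearDet g = -1 := by
  refine eq_or_eq_neg_of_abs_eq ?_
  have h := g.linearIsometryEquiv.toLinearIsometry.normDet_eq_one
  rwa [LinearMap.normDet_eq_abs_det] at h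

theorem isMonocoronalRigid_tiling (s : ℕ → Fin m) (hm : 3 ≤ m) :
    IsMonocoronalRigid (B.tiling s) := by
  let i₀ : Fin m := ⟨0, by omega⟩
  let i₁ : Fin m := ⟨1, by omega⟩
  let i₂ : Fin m := ⟨2, by omega⟩
  have key : ∀ x, IsVertex (B.tiling s) x →
      ∃ (h : ℤ) (g : Space (m + 1) ≃ᵃⁱ[ℝ] Space (m + 1)), B.coord x 0 = h ∧
        g • B.pair i₀ = B.neighbours s h ∧ g • (0 : Space (m + 1)) = x ∧ linearDet g = 1 := by
    intro x hx
    obtain ⟨h, g, hh, hg, hg0⟩ := B.exists_smul_pair_of_isVertex hx i₀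
    rcases linearDet_eq_one_or g with h1 | h1
    · exact ⟨h, g, hh, hg, hg0, h1⟩
    -- Exchanging two edges other than `i₀` fixes `0` and preserves `pair i₀`, but has determinant
    -- `-1`.
    · refine ⟨h, g * linear (B.edgeSwap i₁ i₂), hh, ?_, ?_, ?_⟩
      · rw [mul_smul, edgeSwap_smul_pair, Equiv.swap_apply_of_ne_of_ne, hg] <;>
          simp [i₀, i₁, i₂]
      · rw [mul_smul, linear_smul, map_zero, hg0]
      · rw [map_mul, h1, B.linearDet_linear_edgeSwap (by simp [i₁, i₂])]
        norm_num
  intro x y hx hy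
  obtain ⟨h, f, hh, hf, rfl, hf1⟩ := key x hx
  obtain ⟨k, g, hk, hg, rfl, hg1⟩ := key y hy
  refine ⟨_, _, ?_, B.carries_corona (g := g * f⁻¹) hh hk ?_ ?_⟩
  · have h1 : linearDet (g * f⁻¹) * linearDet f = 1 := by
      rw [← map_mul, inv_mul_cancel_right, hg1]
    rwa [hf1, mul_one] at h1
  · rw [mul_smul, ← hf, inv_smul_smul, hg]
  · rw [mul_smul, inv_smul_smul]

end Frame

/-! ### The recurrence and divisibility by 2 -/

/-- Integer solutions of `2 p (l + 2) + 3 p (l + 1) + 2 p l = 0` are highly divisible by `2` far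
from the ends of the range in which the recurrence holds. -/
theorem two_pow_dvd_of_recurrence {p : ℕ → ℤ} {N : ℕ}
    (hp : ∀ l, l + 2 < N → 2 * p (l + 2) + 3 * p (l + 1) + 2 * p l = 0) (j : ℕ) :
    ∀ l, j ≤ l → l + j < N → (2 : ℤ) ^ j ∣ p l := by
  induction j with
  | zero => simp
  | succ j ih =>
    intro l hl hN
    obtain ⟨l, rfl⟩ := Nat.exists_eq_add_of_le' (show 1 ≤ l by omega)
    obtain ⟨a, ha⟩ := ih l (by omega) (by omega)
    obtain ⟨b, hb⟩ := ih (l + 2) (by omega) (by omega)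
    -- Both neighbours are divisible by `2 ^ j` and enter with coefficient 2, which gains one
    -- factor.
    have h3 : (2 : ℤ) ^ (j + 1) ∣ 3 * p (l + 1) := by
      refine ⟨-(a + b), ?_⟩
      rw [pow_succ]
      linear_combination hp l (by omega) - 2 * hb - 2 * ha
    refine IsCoprime.dvd_of_dvd_mul_left (IsCoprime.pow_left ?_) h3
    exact ⟨-1, 1, by norm_num⟩

/-- Positions `j` and `j + 1` are far enough from both ends for divisibility to beat the bound; two
consecutive zeros propagate in both directions. -/
theorem eq_zero_of_recurrence {p : ℕ → ℤ} {N j : ℕ}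
    (hp : ∀ l, l + 2 < N → 2 * p (l + 2) + 3 * p (l + 1) + 2 * p l = 0)
    (hbound : ∀ l < N, |p l| < 2 ^ j) (hN : 2 * j + 1 < N) {l : ℕ} (hl : l < N) : p l = 0 := by
  have hzero : ∀ l, j ≤ l → l + j < N → p l = 0 := fun l h1 h2 =>
    Int.eq_zero_of_abs_lt_dvd (two_pow_dvd_of_recurrence hp j l h1 h2) (hbound l (by omega))
  have h0 := hzero j le_rfl (by omega)
  have h1 := hzero (j + 1) (by omega) (by omega)
  have hup : ∀ i, (j + i < N → p (j + i) = 0) ∧ (j + i + 1 < N → p (j + i + 1) = 0) := fun i => by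
    induction i with
    | zero => exact ⟨fun _ => h0, fun _ => h1⟩
    | succ i ih =>
      refine ⟨ih.2, fun h => ?_⟩
      have e := hp (j + i) (by omega)
      rw [ih.1 (by omega), ih.2 (by omega)] at e
      rw [show j + (i + 1) + 1 = j + i + 2 by ring]
      omega
  have hdown : ∀ i, i ≤ j → p (j - i) = 0 ∧ p (j - i + 1) = 0 := fun i => by
    induction i with
    | zero => exact fun _ => ⟨h0, h1⟩
    | succ i ih =>
      intro hi
      have e := hp (j - (i + 1)) (by omega)
      rw [show j - (i + 1) + 2 = j - i + 1 by omega, show j - (i + 1) + 1 = j - i by omega,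
        (ih (by omega)).1, (ih (by omega)).2] at e
      rw [show j - (i + 1) + 1 = j - i by omega]
      exact ⟨by omega, (ih (by omega)).1⟩
  rcases le_total j l with h | h
  · have := (hup (l - j)).1 (by omega)
    rwa [Nat.add_sub_cancel' h] at this
  · have := (hdown (j - l) (by omega)).1
    rwa [Nat.sub_sub_self h] at this

/-- Solutions of the recurrence that start with an odd integer have growing denominators. -/
theorem ne_intCast_of_recurrence {p : ℕ → ℝ} {N : ℕ} {a b : ℤ} (ha : Odd a) (h0 : p 0 = a)
    (h1 : p 1 = b - 3 / 2 * p 0) (hp : ∀ l, l + 2 < N → p (l + 2) = -p l - 3 / 2 * p (l + 1))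
    {l : ℕ} (hl : 0 < l) (hN : l < N) (k : ℤ) : p l ≠ k := by
  -- The numbers `q l = 2 ^ l * p l` satisfy `q (l + 2) = -4 * q l - 3 * q (l + 1)`, so they stay
  -- odd.
  have key : ∀ l, l + 1 < N → (∃ q : ℤ, Odd q ∧ 2 ^ l * p l = q) ∧
      ∃ q : ℤ, Odd q ∧ 2 ^ (l + 1) * p (l + 1) = q := fun l => by
    induction l with
    | zero =>
      refine fun _ => ⟨⟨a, ha, by simp [h0]⟩, 2 * b - 3 * a, ?_, ?_⟩
      · obtain ⟨c, rfl⟩ := ha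
        exact ⟨b - 3 * c - 2, by ring⟩
      · rw [zero_add, h1, h0]
        push_cast
        ring
    | succ l ih =>
      intro h
      obtain ⟨⟨q, ⟨c, rfl⟩, hq⟩, r, ⟨d, rfl⟩, hr⟩ := ih (by omega)
      refine ⟨⟨_, ⟨d, rfl⟩, hr⟩, -4 * (2 * c + 1) - 3 * (2 * d + 1), ⟨-4 * c - 3 * d - 4, by ring⟩, ?_⟩
      rw [show l + 1 + 1 = l + 2 by ring, hp l (by omega)]
      push_cast at hq hr ⊢
      rw [← hq, ← hr]
      ring
  obtain ⟨l, rfl⟩ := Nat.exists_eq_add_of_le' hl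
  obtain ⟨q, hq, he⟩ := (key l (by omega)).2
  intro hk
  rw [hk] at he
  have he' : 2 ^ (l + 1) * k = q := by exact_mod_cast he
  rw [← he', pow_succ, mul_right_comm, mul_comm] at hq
  exact Int.not_even_iff_odd.2 hq (even_two_mul _)

/-! ### The alternating sequence -/

/-- A sequence of indices that, between any two consecutive powers of `2`, alternates between two
cyclically neighbouring indices. -/
def alternating {m : ℕ} (hm : 2 ≤ m) (n : ℕ) : Fin m :=
  ⟨(Nat.log 2 n + n % 2) % m, Nat.mod_lt _ (by omega)⟩

theorem log_two_pow_add {k l : ℕ} (hl : l < 2 ^ k) : Nat.log 2 (2 ^ k + l) = k :=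
  Nat.log_eq_of_pow_le_of_lt_pow (by omega) (by rw [pow_succ]; omega)

theorem alternating_add_two {m : ℕ} (hm : 2 ≤ m) {k l : ℕ} (hl : l + 2 < 2 ^ k) :
    alternating hm (2 ^ k + (l + 2)) = alternating hm (2 ^ k + l) := by
  simp only [alternating, log_two_pow_add hl, log_two_pow_add (show l < 2 ^ k by omega)]
  simp only [← add_assoc, Nat.add_mod_right]

theorem alternating_add_one_ne {m : ℕ} (hm : 2 ≤ m) {k l : ℕ} (hl : l + 1 < 2 ^ k) :
    alternating hm (2 ^ k + l) ≠ alternating hm (2 ^ k + (l + 1)) := by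
  simp only [alternating, log_two_pow_add hl, log_two_pow_add (show l < 2 ^ k by omega), ne_eq,
    Fin.mk.injEq]
  intro h
  have h' : (2 ^ k + l) % 2 ≡ (2 ^ k + (l + 1)) % 2 [MOD m] := Nat.ModEq.add_left_cancel' k h
  have h'' := Nat.ModEq.eq_of_lt_of_lt h' (by omega) (by omega)
  omega

theorem exists_alternating_eq {m : ℕ} (hm : 2 ≤ m) (i : Fin m) (j : ℕ) :
    ∃ k, j ≤ k ∧ alternating hm (2 ^ k) = i := by
  refine ⟨i + m * (j + 1), ?_, ?_⟩
  · nlinarith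
  · have h : 2 ^ ((i : ℕ) + m * (j + 1)) % 2 = 0 := by
      refine Nat.mod_eq_zero_of_dvd (dvd_pow_self 2 ?_)
      have : 0 < m * (j + 1) := by positivity
      omega
    ext
    simp only [alternating, h]
    rw [Nat.log_pow (by norm_num), add_zero, Nat.add_mul_mod_self_left, Nat.mod_eq_of_lt i.2]

/-! ### Absence of periods -/

theorem linearIsometryEquiv_eq_of_mul_translation {d : ℕ} {g : Space d ≃ᵃⁱ[ℝ] Space d}
    {v w : Space d} (h : g * translation v = translation w * g) : g.linearIsometryEquiv v = w := by
  rw [mul_translation] at h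
  have := congrArg (fun f => f • (0 : Space d)) (mul_right_cancel h)
  simpa using this

namespace Frame

variable {m : ℕ} (B : Frame m)

theorem mirror_mul_linearIsometryEquiv (i : Fin m) (g : Space (m + 1) ≃ᵃⁱ[ℝ] Space (m + 1))
    (v : Space (m + 1)) : (B.mirror i * g).linearIsometryEquiv v =
      B.edgeFlip i (g.linearIsometryEquiv v) :=
  linearIsometryEquiv_eq_of_mul_translation <| by
    rw [mul_assoc, mul_translation g, ← mul_assoc, mirror_mul_translation, mul_assoc]

theorem inner_edge_edgeFlip_of_ne {i j : Fin m} (hij : i ≠ j) (x : Space (m + 1)) :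
    ⟪B.edge j, B.edgeFlip i x⟫ = ⟪B.edge j, x⟫ - 3 / 2 * ⟪B.edge i, x⟫ := by
  rw [edgeFlip_apply, inner_sub_right, inner_smul_right, inner_edge_edge, if_neg hij.symm]
  ring

theorem inner_edge_edgeFlip_self (i : Fin m) (x : Space (m + 1)) :
    ⟪B.edge i, B.edgeFlip i x⟫ = -⟪B.edge i, x⟫ := by
  rw [edgeFlip_apply, inner_sub_right, inner_smul_right, inner_edge_self]
  ring

theorem inner_edge_recurrence {i j : Fin m} (hij : i ≠ j) (x : Space (m + 1)) :
    ⟪B.edge i, B.edgeFlip j (B.edgeFlip i x)⟫ =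
      -⟪B.edge i, x⟫ - 3 / 2 * ⟪B.edge j, B.edgeFlip i x⟫ := by
  rw [inner_edge_edgeFlip_of_ne B hij.symm, inner_edge_edgeFlip_self]

/-- A vector orthogonal to the axis and to all edges is zero. -/
theorem eq_zero_of_inner_edge {x : Space (m + 1)} (h0 : B.coord x 0 = 0)
    (h : ∀ i, ⟪B.edge i, x⟫ = 0) : x = 0 := by
  have hx := congrArg (fun z => ⟪z, x⟫) (B.eq_sum x)
  rw [← inner_self_eq_zero (𝕜 := ℝ)]
  simpa [inner_add_left, inner_smul_left, sum_inner, h0, h] using hx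

/-- A vector that stays in the lattice under all products of the flips along the alternating
sequence is zero. -/
theorem eq_zero_of_forall_mem_lattice (hm : 2 ≤ m) {x : ℕ → Space (m + 1)}
    (hx : ∀ n, x (n + 1) = B.edgeFlip (alternating hm n) (x n)) (hmem : ∀ n, x n ∈ B.lattice) :
    x 0 = 0 := by
  have hnorm : ∀ n, ‖x n‖ = ‖x 0‖ := fun n => by
    induction n with
    | zero => rfl
    | succ n ih => rw [hx, LinearIsometryEquiv.norm_map, ih]
  choose p hp using fun n => B.exists_inner_eq_intCast (hmem n) (alternating hm n)
  -- Edges have norm 2 and flips preserve norms, so `2 * ‖x 0‖` bounds every `|p n|`.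
  obtain ⟨j, hj⟩ := pow_unbounded_of_one_lt (2 * ‖x 0‖) (show (1 : ℝ) < 2 by norm_num)
  have hedge : ∀ i, ‖B.edge i‖ = 2 := fun i => by
    rw [← sq_eq_sq₀ (norm_nonneg _) (by norm_num), ← real_inner_self_eq_norm_sq, inner_edge_self]
    norm_num
  have hbound : ∀ n, |p n| < 2 ^ j := fun n => by
    have h := abs_real_inner_le_norm (B.edge (alternating hm n)) (x n)
    rw [hp, hedge, hnorm] at h
    exact_mod_cast h.trans_lt hj
  have hblock : ∀ k, j + 1 ≤ k → ∀ l, l < 2 ^ k → p (2 ^ k + l) = 0 := fun k hk l hl => by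
    refine eq_zero_of_recurrence (p := fun l => p (2 ^ k + l)) (N := 2 ^ k) (j := j) ?_
      (fun l _ => hbound _) ?_ hl
    · intro l hl
      have h := B.inner_edge_recurrence
        (alternating_add_one_ne hm (show l + 1 < 2 ^ k by omega)) (x (2 ^ k + l))
      rw [← hx, add_assoc, ← hx, hp, hp, ← alternating_add_two hm hl, add_assoc, hp] at h
      have h' : (2 * p (2 ^ k + (l + 2)) + 3 * p (2 ^ k + (l + 1)) + 2 * p (2 ^ k + l) : ℝ) = 0 := by
        linarith
      exact_mod_cast h'
    · calc 2 * j + 1 < 2 * (j + 1) := by omega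
        _ ≤ 2 * 2 ^ j := Nat.mul_le_mul_left 2 j.lt_two_pow_self
        _ = 2 ^ (j + 1) := by ring
        _ ≤ 2 ^ k := Nat.pow_le_pow_right (by norm_num) hk
  have hzero : ∀ n, 2 ^ (j + 1) ≤ n → p n = 0 := fun n hn => by
    have hn0 : n ≠ 0 := ((Nat.two_pow_pos _).trans_le hn).ne'
    have h1 := Nat.pow_log_le_self 2 hn0
    have h2 := Nat.lt_pow_succ_log_self (show 1 < 2 by norm_num) n
    have h3 := hblock (Nat.log 2 n) (Nat.le_log_of_pow_le (by norm_num) hn)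
      (n - 2 ^ Nat.log 2 n) (by rw [pow_succ] at h2; omega)
    rwa [Nat.add_sub_cancel' h1] at h3
  -- A flip along an edge orthogonal to `x n` fixes it. As every index recurs, the eventual constant
  -- is orthogonal to all edges.
  have hconst : ∀ n, 2 ^ (j + 1) ≤ n → x n = x (2 ^ (j + 1)) := fun n hn => by
    induction n, hn using Nat.le_induction with
    | base => rfl
    | succ n hn ih => rw [hx, edgeFlip_apply, hp, hzero n hn, ih]; simp
  have hlast : x (2 ^ (j + 1)) = 0 := by
    refine B.eq_zero_of_inner_edge ?_ fun i => ?_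
    · obtain ⟨a, h0, ha⟩ := hmem (2 ^ (j + 1))
      simp [ha, h0]
    · obtain ⟨k, hk, rfl⟩ := exists_alternating_eq hm i (j + 1)
      have hle : 2 ^ (j + 1) ≤ 2 ^ k := Nat.pow_le_pow_right (by norm_num) hk
      rw [← hconst _ hle, hp, hzero _ hle, Int.cast_zero]
  rw [← norm_eq_zero, ← hnorm, hlast, norm_zero]

/-- An edge vector leaves the lattice under alternating flips. -/
theorem not_mem_lattice_of_alternating (hm : 2 ≤ m) {y : ℕ → Space (m + 1)} {k l : ℕ}
    (h0 : y 0 = B.edge (alternating hm (2 ^ k + 1)))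
    (hy : ∀ n, y (n + 1) = B.edgeFlip (alternating hm (2 ^ k + n)) (y n))
    (hl : 0 < l) (hlk : l < 2 ^ k) : y l ∉ B.lattice := by
  intro hmem
  obtain ⟨q, hq⟩ := B.exists_inner_eq_intCast hmem (alternating hm (2 ^ k + l))
  have hne : alternating hm (2 ^ k + 0) ≠ alternating hm (2 ^ k + 1) :=
    alternating_add_one_ne hm (by omega)
  refine ne_intCast_of_recurrence (p := fun l => ⟪B.edge (alternating hm (2 ^ k + l)), y l⟫)
    (N := 2 ^ k) (a := 3) (b := 4) (by decide) ?_ ?_ ?_ hl hlk q hq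
  · simp only [h0, inner_edge_edge, if_neg hne]
    norm_num
  · have h1 := hy 0
    rw [zero_add] at h1
    simp only [h1]
    rw [inner_edge_edgeFlip_of_ne B hne, h0, inner_edge_self]
    norm_num
  · intro l hl
    have h := B.inner_edge_recurrence
      (alternating_add_one_ne hm (show l + 1 < 2 ^ k by omega)) (y l)
    rw [← hy, ← hy] at h
    simpa only [alternating_add_two hm hl] using h

theorem mem_lattice_of_translation_smul_cell {c c' : Fin (m + 1) → ℤ} {v : Space (m + 1)}
    (h : translation v • B.cell c = B.cell c') (h0 : c' 0 = c 0) : v ∈ B.lattice :=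
  ⟨c' - c, by simp [h0], fun i => by simp [B.coord_of_translation_smul_cell h]⟩

theorem coord_zero_of_translation_smul_tile {s : ℕ → Fin m} {c c' : Fin (m + 1) → ℤ}
    {v : Space (m + 1)} (h : translation v • B.tile s c = B.tile s c') :
    B.coord v 0 = c' 0 - c 0 := by
  have key : ∀ x ∈ B.cell c, B.coord v 0 + B.coord x 0 ∈ Set.Icc (c' 0 : ℝ) (c' 0 + 1) := by
    intro x hx
    have hx' : translation v • B.stack s (c 0).natAbs • x ∈ B.tile s c' :=
      h ▸ Set.smul_mem_smul_set (Set.smul_mem_smul_set hx)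
    simpa [coord_stack_zero] using B.height_mem_of_mem_tile hx'
  have h1 := (key (B.coord.symm fun i => c i) fun i => by simp).1
  have h2 := (key (B.coord.symm fun i => c i + 1) fun i => by simp).2
  simp at h1 h2
  linarith

theorem exists_translation_smul_tile {s : ℕ → Fin m} {v : Space (m + 1)}
    (hv : v ∈ translationVectors (B.tiling s)) (c : Fin (m + 1) → ℤ) :
    ∃ c', translation v • B.tile s c = B.tile s c' := by
  have hv' : (fun T : Set (Space (m + 1)) => IsometryEquiv.addRight v '' T) '' B.tiling s =
    B.tiling s := hv
  obtain ⟨c', hc'⟩ := hv'.subset ⟨_, ⟨c, rfl⟩, rfl⟩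
  refine ⟨c', hc'.symm ▸ Set.image_congr fun x _ => ?_⟩
  simp [add_comm]

theorem mem_lattice_of_translation_smul_tile {s : ℕ → Fin m} {c c' : Fin (m + 1) → ℤ}
    {v : Space (m + 1)} (h : translation v • B.tile s c = B.tile s c') (h0 : c' 0 = c 0) :
    (B.stack s (c 0).natAbs)⁻¹.linearIsometryEquiv v ∈ B.lattice := by
  refine B.mem_lattice_of_translation_smul_cell ?_ h0
  rw [tile, tile, h0] at h
  have e := congrArg ((B.stack s (c 0).natAbs)⁻¹ • ·) h
  simp only [inv_smul_smul] at e
  rwa [smul_smul, mul_translation, mul_smul, inv_smul_smul] at e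

theorem translation_comm {d : ℕ} (v w : Space d) :
    translation v * translation w = translation w * translation v :=
  affineIsometry_ext fun x => by
    simp only [mul_smul, translation_smul]
    abel

theorem translation_edge_smul_cell (i : Fin m) (c : Fin (m + 1) → ℤ) :
    translation (B.edge i) • B.cell c = B.cell (c + Pi.single i.succ 1) :=
  B.smul_cell_eq (B.translation_smul_mem_cell (fun j => by
    simp [edge, coord_basis, Pi.single_apply, eq_comm (a := j)]) c)

/-- Two tiles one edge apart go to two tiles of a common layer; seen from that layer, their
difference is the transformed edge and must be a lattice vector. -/
theorem edge_mem_lattice_of_translation_smul_tile {s : ℕ → Fin m}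
    {c c₁ c₂ : Fin (m + 1) → ℤ} {v : Space (m + 1)} {i : Fin m}
    (h₁ : translation v • B.tile s c = B.tile s c₁)
    (h₂ : translation v • B.tile s (c + Pi.single i.succ 1) = B.tile s c₂) (h0 : c₂ 0 = c₁ 0) :
    ((B.stack s (c₁ 0).natAbs)⁻¹ * B.stack s (c 0).natAbs).linearIsometryEquiv (B.edge i) ∈
      B.lattice := by
  refine B.mem_lattice_of_translation_smul_cell (c := c₁) (c' := c₂) ?_ h0
  have hc : (c + Pi.single i.succ 1 : Fin (m + 1) → ℤ) 0 = c 0 := by simp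
  rw [tile, tile] at h₁ h₂
  rw [hc, h0, ← translation_edge_smul_cell] at h₂
  generalize B.stack s (c 0).natAbs = a at *
  generalize B.stack s (c₁ 0).natAbs = b at *
  have e₁ : b⁻¹ • translation v • a • B.cell c = B.cell c₁ := by rw [h₁, inv_smul_smul]
  have e₂ : b⁻¹ • translation v • a • translation (B.edge i) • B.cell c = B.cell c₂ := by
    rw [h₂, inv_smul_smul]
  rw [← e₁, ← e₂]
  simp only [smul_smul]
  congr 1
  have e : ∀ x, b⁻¹ * (translation v * x) =
      translation (b⁻¹.linearIsometryEquiv v) * (b⁻¹ * x) := fun x => by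
    rw [← mul_assoc, mul_translation, mul_assoc]
  rw [e, e, ← mul_assoc (translation _), translation_comm, mul_assoc, ← mul_translation, mul_assoc]

theorem translationVectors_tiling (hm : 2 ≤ m) {v : Space (m + 1)}
    (hv : v ∈ translationVectors (B.tiling (alternating hm))) : v = 0 := by
  choose f hf using B.exists_translation_smul_tile hv
  have hheight : ∀ c, (f c 0 : ℝ) = c 0 + B.coord v 0 := fun c => by
    rw [B.coord_zero_of_translation_smul_tile (hf c)]
    ring
  obtain ⟨k, hk⟩ : ∃ k : ℤ, ∀ c, f c 0 = c 0 + k :=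
    ⟨f 0 0, fun c => by
      have h := hheight 0
      rw [Pi.zero_apply, Int.cast_zero, zero_add] at h
      have h' := hheight c
      rw [← h] at h'
      exact_mod_cast h'⟩
  rcases eq_or_ne k 0 with rfl | hk0
  · refine B.eq_zero_of_forall_mem_lattice hm
      (x := fun n => (B.stack (alternating hm) n)⁻¹.linearIsometryEquiv v) (fun n => ?_) fun n => ?_
    · rw [stack, mul_inv_rev, mirror_inv, mirror_mul_linearIsometryEquiv]
    · simpa using B.mem_lattice_of_translation_smul_tile (hf (Fin.cons n 0)) (by rw [hk, add_zero])
  · exfalso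
    obtain ⟨K, hK⟩ : ∃ K, k.natAbs < 2 ^ K := ⟨_, Nat.lt_two_pow_self⟩
    refine B.not_mem_lattice_of_alternating hm (k := K) (l := k.natAbs)
      (y := fun l => ((B.stack (alternating hm) (2 ^ K + l))⁻¹ *
        B.stack (alternating hm) (2 ^ K)).linearIsometryEquiv
          (B.edge (alternating hm (2 ^ K + 1)))) ?_ ?_ (Int.natAbs_pos.2 hk0) hK ?_
    · simp only [add_zero, inv_mul_cancel]
      rfl
    · intro l
      rw [← add_assoc, stack, mul_inv_rev, mirror_inv, mul_assoc, mirror_mul_linearIsometryEquiv]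
    -- Giving `n` the sign of `k` makes absolute heights add, so the mirrors between the two layers
    -- belong to one alternating block.
    · obtain ⟨n, hn, hnk⟩ : ∃ n : ℤ, n.natAbs = 2 ^ K ∧ (n + k).natAbs = 2 ^ K + k.natAbs := by
        rcases lt_or_gt_of_ne hk0 with h | h
        · exact ⟨-(2 ^ K : ℕ), by omega, by omega⟩
        · exact ⟨(2 ^ K : ℕ), by omega, by omega⟩
      have h := B.edge_mem_lattice_of_translation_smul_tile (c := Fin.cons n 0)
        (i := alternating hm (2 ^ K + 1)) (hf _) (hf _) (by simp [hk])
      rwa [hk, Fin.cons_zero, hn, hnk] at h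

theorem isNonPeriodic_tiling (hm : 2 ≤ m) : IsNonPeriodic (B.tiling (alternating hm)) := by
  have h : translationVectors (B.tiling (alternating hm)) ⊆ {0} :=
    fun v hv => B.translationVectors_tiling hm hv
  rw [IsNonPeriodic, IsKPeriodic, Submodule.span_eq_bot.2 h, finrank_bot]

end Frame

end Tilings

theorem theorem3p2 :
    (∀ d : ℕ, 3 ≤ d → ∃ 𝒯 : Set (Set (Tilings.Space d)),
      Tilings.IsPolytopeTiling 𝒯 ∧ Tilings.IsNonPeriodic 𝒯 ∧
        ¬ Tilings.IsFaceToFace 𝒯 ∧ Tilings.IsMonocoronal 𝒯) ∧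
    (∀ d : ℕ, 4 ≤ d → ∃ 𝒯 : Set (Set (Tilings.Space d)),
      Tilings.IsPolytopeTiling 𝒯 ∧ Tilings.IsNonPeriodic 𝒯 ∧
        ¬ Tilings.IsFaceToFace 𝒯 ∧ Tilings.IsMonocoronalRigid 𝒯) := by
  constructor
  · intro d hd
    obtain ⟨m, rfl⟩ := Nat.exists_eq_add_of_le' (show 1 ≤ d by omega)
    obtain ⟨B⟩ := Tilings.exists_frame m
    have hm : 2 ≤ m := by omega
    exact ⟨B.tiling (Tilings.alternating hm), B.isPolytopeTiling_tiling _,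
      B.isNonPeriodic_tiling hm, B.not_isFaceToFace_tiling _, B.isMonocoronal_tiling _⟩
  · intro d hd
    obtain ⟨m, rfl⟩ := Nat.exists_eq_add_of_le' (show 1 ≤ d by omega)
    obtain ⟨B⟩ := Tilings.exists_frame m
    have hm : 2 ≤ m := by omega
    exact ⟨B.tiling (Tilings.alternating hm), B.isPolytopeTiling_tiling _,
      B.isNonPeriodic_tiling hm, B.not_isFaceToFace_tiling _,
      B.isMonocoronalRigid_tiling _ (by omega)⟩
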